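/- Let $c,\lambda>0$. Let $V(0)$ be a random variable with $P\{V(0)=c\}=P\{V(0)=-c\}=\tfrac12$, let $N$ be a homogeneous Poisson process with rate $\lambda$, independent of $V(0)$, and let $\mathcal T(s)=\int_0^s V(0)(-1)^{N(u)}\,du$, $s\ge 0$, be the symmetric telegraph process. Fix $t>0$ and an integer $k\ge 0$. The maximum $\max_{0\le s\le t}\mathcal T(s)$ is almost surely attained and is a random variable, the event $\{V(0)=-c,\ N(t)=2k+1\}$ has positive probability, and the following hold. (i) On the interval $0<\beta<ct$, the conditional law of the maximum given $V(0)=-c$ and $N(t)=2k+1$ has the density $$P\Big\{\max_{0\le s\le t}\mathcal T(s)\in d\beta\ \Big|\ V(0)=-c,\,N(t)=2k+1\Big\}=\left(\frac{(2k+1)!}{(k-1)!\,(k+1)!}\,\frac{(c^2t^2-\beta^2)^{k-1}(ct-\beta)}{(2ct)^{2k}}+\frac{(2k+1)!}{k!\,(k+1)!}\,\frac{(c^2t^2-\beta^2)^{k}}{(2ct)^{2k+1}}\right)d\beta ,$$ where the first summand is $0$ for $k=0$ (convention $1/(-1)!=0$). (ii) On $0<\beta<ct$, the conditional laws of the maximum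 given $V(0)=-c$, $N(t)=2k$ and given $V(0)=c$, $N(t)=2k+1$ have continuous densities too, and $$P\Big\{\max_{0\le s\le t}\mathcal T(s)\in d\beta\,\Big|\,V(0)=-c,N(t)=2k+1\Big\}=\frac{2k+1}{2k+2}\,P\Big\{\max_{0\le s\le t}\mathcal T(s)\in d\beta\,\Big|\,V(0)=-c,N(t)=2k\Big\}+\frac{1}{2k+2}\,P\Big\{\max_{0\le s\le t}\mathcal T(s)\in d\beta\,\Big|\,V(0)=c,N(t)=2k+1\Big\}.$$ (iii) The conditional law has an atom at $0$: $$P\Big\{\max_{0\le s\le t}\mathcal T(s)=0\ \Big|\ V(0)=-c,\,N(t)=2k+1\Big\}=\binom{2k+1}{k}\frac1{2^{2k+1}} .$$ -/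

import Mathlib

open MeasureTheory ProbabilityTheory Set
open scoped NNReal ENNReal

noncomputable section

/-- `N` is a homogeneous Poisson process of rate `lam` under `P`: it counts the arrivals up to
time `t`, where the successive interarrival times `X 0, X 1, …` are independent and exponentially
distributed with rate `lam`. The `n`-th arrival (counted from `0`) is at time
`X 0 + ⋯ + X n`. -/
structure IsPoissonProcess {Ω : Type*} [MeasurableSpace Ω] (P : Measure Ω) (lam : ℝ)
    (N : ℝ≥0 → Ω → ℕ) : Prop where
  rate_pos : 0 < lam
  measurable : ∀ t, Measurable (N t)
  exists_interarrival : ∃ X : ℕ → Ω → ℝ,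
    (∀ i, Measurable (X i)) ∧ iIndepFun X P ∧ (∀ i, P.map (X i) = expMeasure lam) ∧
      ∀ᵐ ω ∂P, ∀ t : ℝ≥0, N t ω = {n : ℕ | ∑ i ∈ Finset.range (n + 1), X i ω ≤ t}.ncard

/-- The random data of a symmetric telegraph process with speed `c` and rate `lam`: an initial
velocity `V` equal to `c` or `-c` with probability `1/2` each, and a Poisson process `N` of rate
`lam`, the whole process `N` being independent of `V`. -/
structure IsTelegraphData {Ω : Type*} [MeasurableSpace Ω] (P : Measure Ω) (c lam : ℝ)
    (V : Ω → ℝ) (N : ℝ≥0 → Ω → ℕ) : Prop where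
  speed_pos : 0 < c
  measurable_velocity : Measurable V
  prob_right : P {ω | V ω = c} = 1 / 2
  prob_left : P {ω | V ω = -c} = 1 / 2
  poisson : IsPoissonProcess P lam N
  indep : IndepFun V (fun ω (s : ℝ≥0) => N s ω) P

/-- The position of the telegraph process at time `t ≥ 0`: the integral over `[0, t]` of the
velocity `V (-1) ^ N(s)`. -/
def telegraph {Ω : Type*} (V : Ω → ℝ) (N : ℝ≥0 → Ω → ℕ) (t : ℝ) (ω : Ω) : ℝ :=
  ∫ s in (0 : ℝ)..t, V ω * (-1) ^ N s.toNNReal ω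

/-- The maximum of the telegraph process over the time interval `[0, t]`. -/
def telegraphMax {Ω : Type*} (V : Ω → ℝ) (N : ℝ≥0 → Ω → ℕ) (t : ℝ) (ω : Ω) : ℝ :=
  sSup ((fun s => telegraph V N s ω) '' Icc 0 t)

/-- The conditional law of the maximum over `[0, t]` given `V = v` and `N(t) = n`. -/
def condMaxLaw {Ω : Type*} [MeasurableSpace Ω] (P : Measure Ω) (V : Ω → ℝ) (N : ℝ≥0 → Ω → ℕ)
    (t v : ℝ) (n : ℕ) : Measure ℝ :=
  (P[|{ω | V ω = v ∧ N t.toNNReal ω = n}]).map (telegraphMax V N t)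

/-- `f` is the (continuous) density of `μ` on the set `I`. Nothing is said about `μ` outside `I`,
where it may have atoms. -/
structure IsDensityOn (μ : Measure ℝ) (I : Set ℝ) (f : ℝ → ℝ) : Prop where
  continuousOn : ContinuousOn f I
  nonneg : ∀ x ∈ I, 0 ≤ f x
  restrict_eq : μ.restrict I = (volume.restrict I).withDensity (fun x => ENNReal.ofReal (f x))

/-- The explicit density
`(2k+1)! / ((k-1)! (k+1)!) * (c²t² - β²)^(k-1) (ct - β) / (2ct)^(2k)
  + (2k+1)! / (k! (k+1)!) * (c²t² - β²)^k / (2ct)^(2k+1)`.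
Here `1 / (k-1)!` is written `k / k!`, which is `0` for `k = 0`, in agreement with the usual
convention `1 / (-1)! = 0`. -/
def leftOddDensity (c t : ℝ) (k : ℕ) (β : ℝ) : ℝ :=
  k * ((2 * k + 1).factorial : ℝ) / ((k.factorial : ℝ) * ((k + 1).factorial : ℝ))
      * ((c ^ 2 * t ^ 2 - β ^ 2) ^ (k - 1) * (c * t - β) / (2 * c * t) ^ (2 * k))
    + ((2 * k + 1).factorial : ℝ) / ((k.factorial : ℝ) * ((k + 1).factorial : ℝ))
      * ((c ^ 2 * t ^ 2 - β ^ 2) ^ k / (2 * c * t) ^ (2 * k + 1))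

end

/-! Take speed `1`, level `b` and time `t`, and condition on the first waiting time `y`. A path
starting to the left must then climb `b + y` in time `t - y`; one starting to the right must climb
`b - y`, and has already succeeded if `y > b`. The exponential densities multiply to `lam ^ n * exp
(-(lam * t))`, so what remains is the volume of a set of switching times.

In the coordinates `p = (t + b) / 2`, `q = (t - b) / 2`, a first step to the left only lowers `q`
and one to the right only lowers `p`. The renewal recursion thus says that the volumes are
successive antiderivatives in `q` and `p` alternately, with boundary value zero at `q = 0` (left)
and the full simplex volume at `p = q` (right). Pairs of truncated binomial sums solve it:
`integral_exceedVolume_true`, `integral_exceedVolume_false`, `waitingLaw_exceed`.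

Dividing by the Poisson weight removes `lam` and gives the conditional tail. Its derivative in the
level telescopes to two monomials, which yields the densities and, by algebra, their recursion; the
mass missing from the tail at level `0` is the atom. The passage to the process needs waiting times
independent of `V`: they are recovered measurably from the path of `N`. -/

/-! ### Truncated binomial sums and their integral recursion -/

/-- The sum of `p ^ j q ^ (n - j) / (j! (n - j)!)` over `j < m`. -/
noncomputable def partialBinomial (n m : ℕ) (p q : ℝ) : ℝ :=
  ∑ j ∈ Finset.range m, p ^ j / j.factorial * (q ^ (n - j) / (n - j).factorial)

/-- The volume of the set of `n` ordered switching times in `[0, p + q]` for which the telegraph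
path of speed `1` exceeds `p - q`, with initial velocity `1` if `right` and `-1` otherwise. -/
noncomputable def exceedVolume (right : Bool) (n : ℕ) (p q : ℝ) : ℝ :=
  partialBinomial n ((n + 1) / 2) p q + partialBinomial n (if right then n / 2 + 1 else n / 2) p q

lemma partialBinomial_nonneg {n m : ℕ} {p q : ℝ} (hp : 0 ≤ p) (hq : 0 ≤ q) :
    0 ≤ partialBinomial n m p q :=
  Finset.sum_nonneg fun _ _ => by positivity

lemma exceedVolume_nonneg {b : Bool} {n : ℕ} {p q : ℝ} (hp : 0 ≤ p) (hq : 0 ≤ q) :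
    0 ≤ exceedVolume b n p q :=
  add_nonneg (partialBinomial_nonneg hp hq) (partialBinomial_nonneg hp hq)

lemma continuous_partialBinomial (n m : ℕ) :
    Continuous fun z : ℝ × ℝ => partialBinomial n m z.1 z.2 := by
  unfold partialBinomial; fun_prop

lemma continuous_exceedVolume (b : Bool) (n : ℕ) :
    Continuous fun z : ℝ × ℝ => exceedVolume b n z.1 z.2 :=
  (continuous_partialBinomial _ _).add (continuous_partialBinomial _ _)

lemma hasDerivAt_pow_div_factorial (k : ℕ) (x : ℝ) :
    HasDerivAt (fun x : ℝ => x ^ (k + 1) / (k + 1).factorial) (x ^ k / k.factorial) x := by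
  refine ((hasDerivAt_pow (k + 1) x).div_const _).congr_deriv ?_
  rw [Nat.factorial_succ]; push_cast
  have : (k.factorial : ℝ) ≠ 0 := by positivity
  field_simp

/-- Since `j < m ≤ n + 1`, every term carries a positive power of `q`, so none is lost. -/
lemma hasDerivAt_partialBinomial_right {n m : ℕ} (hm : m ≤ n + 1) (p q : ℝ) :
    HasDerivAt (fun q => partialBinomial (n + 1) m p q) (partialBinomial n m p q) q := by
  unfold partialBinomial
  refine HasDerivAt.fun_sum (𝕜 := ℝ) (F := ℝ) fun j hj => ?_
  have hj : j < m := Finset.mem_range.1 hj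
  rw [show n + 1 - j = (n - j) + 1 by omega]
  exact HasDerivAt.const_mul (p ^ j / (j.factorial : ℝ)) (hasDerivAt_pow_div_factorial _ q)

/-- The term `j = 0` is constant in `p` and the others shift down by one, so the truncation index
drops along with the degree. -/
lemma hasDerivAt_partialBinomial_left (n m : ℕ) (p q : ℝ) :
    HasDerivAt (fun p => partialBinomial (n + 1) (m + 1) p q) (partialBinomial n m p q) p := by
  unfold partialBinomial
  simp only [Finset.sum_range_succ' _ m, pow_zero]
  refine (HasDerivAt.fun_sum (𝕜 := ℝ) (F := ℝ) fun j hj => ?_).add_const _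
  rw [show n + 1 - (j + 1) = n - j by omega]
  exact (hasDerivAt_pow_div_factorial _ p).mul_const _

lemma partialBinomial_zero_right {n m : ℕ} (hm : m ≤ n) (p : ℝ) :
    partialBinomial n m p 0 = 0 := by
  refine Finset.sum_eq_zero fun j hj => ?_
  have hj : j < m := Finset.mem_range.1 hj
  rw [zero_pow (by omega)]; simp

lemma partialBinomial_self {n m : ℕ} (hm : m ≤ n + 1) (q : ℝ) :
    partialBinomial n m q q = q ^ n / n.factorial * ∑ j ∈ Finset.range m, (n.choose j : ℝ) := by
  unfold partialBinomial
  rw [Finset.mul_sum]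
  refine Finset.sum_congr rfl fun j hj => ?_
  have hj : j < m := Finset.mem_range.1 hj
  have hjn : j ≤ n := by omega
  rw [Nat.cast_choose ℝ hjn]
  conv_rhs => rw [← Nat.add_sub_cancel' hjn, pow_add, Nat.add_sub_cancel' hjn]
  have : (n.factorial : ℝ) ≠ 0 := by positivity
  field_simp

/-- The reflection `j ↦ n - j` carries the upper part of the row onto the first sum. -/
lemma sum_choose_half_add (n : ℕ) :
    ∑ j ∈ Finset.range ((n + 1) / 2), (n.choose j : ℝ)
      + ∑ j ∈ Finset.range (n / 2 + 1), (n.choose j : ℝ) = 2 ^ n := by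
  have h : ∑ j ∈ Finset.range (n + 1), n.choose j = 2 ^ n := Nat.sum_range_choose n
  rw [← Finset.sum_range_add_sum_Ico _ (show n / 2 + 1 ≤ n + 1 by omega)] at h
  have h2 : ∑ j ∈ Finset.Ico (n / 2 + 1) (n + 1), n.choose j
      = ∑ j ∈ Finset.range ((n + 1) / 2), n.choose j := by
    refine Finset.sum_nbij' (fun j => n - j) (fun j => n - j) ?_ ?_ ?_ ?_ ?_ <;>
      intro j hj <;> simp only [Finset.mem_Ico, Finset.mem_range] at hj ⊢
    · omega
    · omega
    · omega
    · omega
    · exact (Nat.choose_symm (by omega)).symm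
  rw [h2] at h
  rw [add_comm]
  exact_mod_cast h

/-- This is the boundary case `b = 0`: a path starting to the right exceeds `0` at once, so the
whole simplex of side `t = 2 * q` counts. -/
lemma exceedVolume_true_self (n : ℕ) (q : ℝ) :
    exceedVolume true n q q = (2 * q) ^ n / n.factorial := by
  unfold exceedVolume
  rw [partialBinomial_self (by omega), partialBinomial_self (by simp; omega), ← mul_add]
  simp only [if_true]
  rw [sum_choose_half_add, mul_pow]; ring

/-- Renewal step for a first move to the left: `p` is kept, `q` becomes `q - y`, and the
antiderivative vanishes at `q = 0`. -/
lemma integral_exceedVolume_true (n : ℕ) (p q : ℝ) :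
    ∫ y in (0 : ℝ)..q, exceedVolume true n p (q - y) = exceedVolume false (n + 1) p q := by
  have hd : ∀ y ∈ uIcc 0 q, HasDerivAt (fun y => - exceedVolume false (n + 1) p (q - y))
      (exceedVolume true n p (q - y)) y := by
    intro y _
    have h1 := hasDerivAt_partialBinomial_right (n := n) (m := (n + 1) / 2) (by omega) p (q - y)
    have h2 := hasDerivAt_partialBinomial_right (n := n) (m := n / 2 + 1) (by omega) p (q - y)
    have h3 := ((h1.add h2).comp y ((hasDerivAt_id y).const_sub q)).neg
    refine (h3.congr_of_eventuallyEq (Filter.Eventually.of_forall fun z => ?_)).congr_deriv ?_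
    · simp only [exceedVolume, Bool.false_eq_true, if_false, Pi.neg_apply, Function.comp,
        Pi.add_apply]
      rw [show (n + 1 + 1) / 2 = n / 2 + 1 by omega]; ring
    · simp only [exceedVolume, if_true]; ring
  have hc : Continuous fun y => exceedVolume true n p (q - y) :=
    (continuous_exceedVolume true n).comp (f := fun y : ℝ => (p, q - y)) (by fun_prop)
  rw [intervalIntegral.integral_eq_sub_of_hasDerivAt hd (hc.intervalIntegrable _ _)]
  have : exceedVolume false (n + 1) p 0 = 0 := by
    simp only [exceedVolume, Bool.false_eq_true, if_false]
    rw [partialBinomial_zero_right (by omega), partialBinomial_zero_right (by omega), add_zero]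
  simp [this]

/-- Renewal step for a first move to the right, up to `y = p - q = b`. The subtracted term is the
volume of paths whose first move already passes `b`. -/
lemma integral_exceedVolume_false (n : ℕ) (p q : ℝ) :
    ∫ y in (0 : ℝ)..(p - q), exceedVolume false n (p - y) q
      = exceedVolume true (n + 1) p q - (2 * q) ^ (n + 1) / (n + 1).factorial := by
  have hd : ∀ y ∈ uIcc 0 (p - q), HasDerivAt (fun y => - exceedVolume true (n + 1) (p - y) q)
      (exceedVolume false n (p - y) q) y := by
    intro y _
    have h1 := hasDerivAt_partialBinomial_left n ((n + 1) / 2) (p - y) q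
    have h2 := hasDerivAt_partialBinomial_left n (n / 2) (p - y) q
    have h3 := ((h1.add h2).comp y ((hasDerivAt_id y).const_sub p)).neg
    refine (h3.congr_of_eventuallyEq (Filter.Eventually.of_forall fun z => ?_)).congr_deriv ?_
    · simp only [exceedVolume, if_true, Pi.neg_apply, Function.comp, Pi.add_apply]
      rw [show (n + 1 + 1) / 2 = n / 2 + 1 by omega]; ring
    · simp only [exceedVolume, Bool.false_eq_true, if_false]; ring
  have hc : Continuous fun y => exceedVolume false n (p - y) q :=
    (continuous_exceedVolume false n).comp (f := fun y : ℝ => (p - y, q)) (by fun_prop)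
  rw [intervalIntegral.integral_eq_sub_of_hasDerivAt hd (hc.intervalIntegrable _ _)]
  simp only [sub_sub_cancel, exceedVolume_true_self, sub_zero]
  ring

lemma integral_sub_pow_div_factorial (n : ℕ) (a t : ℝ) :
    ∫ y in a..t, (t - y) ^ n / n.factorial = (t - a) ^ (n + 1) / (n + 1).factorial := by
  have hd : ∀ y ∈ uIcc a t, HasDerivAt (fun y => - ((t - y) ^ (n + 1) / (n + 1).factorial))
      ((t - y) ^ n / n.factorial) y := by
    intro y _
    have h3 := ((hasDerivAt_pow_div_factorial n (t - y)).comp y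
      ((hasDerivAt_id y).const_sub t)).neg
    exact h3.congr_deriv (by ring)
  rw [intervalIntegral.integral_eq_sub_of_hasDerivAt hd
    (Continuous.intervalIntegrable (by fun_prop) _ _)]
  simp

/-! ### Differentiation in the level -/

/-- Up to the sign, the derivative of `partialBinomial n m ((t + b) / 2) ((t - b) / 2)` in `b`. -/
noncomputable def binomialTerm (n m : ℕ) (p q : ℝ) : ℝ :=
  if m = 0 then 0 else
    p ^ (m - 1) / (m - 1).factorial * (q ^ (n - m) / (n - m).factorial) / 2

lemma binomialTerm_nonneg {n m : ℕ} {p q : ℝ} (hp : 0 ≤ p) (hq : 0 ≤ q) :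
    0 ≤ binomialTerm n m p q := by
  unfold binomialTerm; split_ifs <;> positivity

lemma continuous_binomialTerm (n m : ℕ) :
    Continuous fun z : ℝ × ℝ => binomialTerm n m z.1 z.2 := by
  unfold binomialTerm; split_ifs <;> fun_prop

/-- The product rule gives two monomials per term, and neighbouring terms cancel; only the last one
survives. The bound `m ≤ n` keeps `n - m` a genuine difference. -/
lemma hasDerivAt_partialBinomial_level {n m : ℕ} (hm : m ≤ n) (t b : ℝ) :
    HasDerivAt (fun b => partialBinomial n m ((t + b) / 2) ((t - b) / 2))
      (-binomialTerm n m ((t + b) / 2) ((t - b) / 2)) b := by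
  induction m with
  | zero => simpa [partialBinomial, binomialTerm] using hasDerivAt_const b (0 : ℝ)
  | succ m ih =>
    have hp : HasDerivAt (fun b : ℝ => (t + b) / 2) (1 / 2) b :=
      ((hasDerivAt_id b).const_add t).div_const 2
    have hq : HasDerivAt (fun b : ℝ => (t - b) / 2) (-1 / 2) b :=
      ((hasDerivAt_id b).const_sub t).div_const 2
    obtain ⟨r, rfl⟩ : ∃ r, n = m + 1 + r := ⟨n - (m + 1), by omega⟩
    have hqq := (hasDerivAt_pow_div_factorial r ((t - b) / 2)).comp b hq
    have h := ih (by omega)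
    have hsum : (fun b => partialBinomial (m + 1 + r) (m + 1) ((t + b) / 2) ((t - b) / 2))
        = fun b => partialBinomial (m + 1 + r) m ((t + b) / 2) ((t - b) / 2)
          + ((t + b) / 2) ^ m / m.factorial * (((t - b) / 2) ^ (r + 1) / (r + 1).factorial) := by
      ext b
      rw [partialBinomial, Finset.sum_range_succ, show m + 1 + r - m = r + 1 by omega]
      rfl
    rw [hsum]
    cases m with
    | zero =>
      simp only [pow_zero, Nat.factorial_zero, Nat.cast_one, div_one, one_mul]
      refine (h.add hqq).congr_deriv ?_
      simp [binomialTerm]; ring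
    | succ m =>
      have hpp := (hasDerivAt_pow_div_factorial m ((t + b) / 2)).comp b hp
      refine (h.add (hpp.mul hqq)).congr_deriv ?_
      simp only [binomialTerm, Function.comp, Nat.succ_ne_zero, if_false,
        show m + 1 + 1 + r - (m + 1) = r + 1 by omega, show m + 1 + 1 + r - (m + 1 + 1) = r by omega,
        Nat.add_sub_cancel]
      ring

/-- The density, up to normalization, of the maximum of the telegraph path of speed `1`. -/
noncomputable def exceedDensity (right : Bool) (n : ℕ) (p q : ℝ) : ℝ :=
  binomialTerm n ((n + 1) / 2) p q + binomialTerm n (if right then n / 2 + 1 else n / 2) p q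

lemma exceedDensity_nonneg {b : Bool} {n : ℕ} {p q : ℝ} (hp : 0 ≤ p) (hq : 0 ≤ q) :
    0 ≤ exceedDensity b n p q :=
  add_nonneg (binomialTerm_nonneg hp hq) (binomialTerm_nonneg hp hq)

lemma continuous_exceedDensity (b : Bool) (n : ℕ) :
    Continuous fun z : ℝ × ℝ => exceedDensity b n z.1 z.2 :=
  (continuous_binomialTerm _ _).add (continuous_binomialTerm _ _)

/-- A path to the right without reversal has a deterministic maximum. There the volume is constant
in the level, but truncated subtraction makes `binomialTerm 0 1` equal to `1 / 2`. -/
lemma hasDerivAt_exceedVolume_level {r : Bool} {n : ℕ} (hn : r = true → n ≠ 0) (t b : ℝ) :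
    HasDerivAt (fun b => exceedVolume r n ((t + b) / 2) ((t - b) / 2))
      (-exceedDensity r n ((t + b) / 2) ((t - b) / 2)) b := by
  refine ((hasDerivAt_partialBinomial_level (by omega) t b).add
    (hasDerivAt_partialBinomial_level ?_ t b)).congr_deriv ?_
  · split_ifs with h
    · have := hn h; omega
    · omega
  · unfold exceedDensity; ring

/-! ### Recursive description of the maximum and of the arrival count -/

/-- The maximum over `[0, t]` of the path started at `0` with velocity `v` whose velocity is
reversed `n` times, the successive waiting times being `x 0, x 1, …`. -/
noncomputable def peak : (n : ℕ) → ℝ → ℝ → (Fin (n + 1) → ℝ) → ℝ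
  | 0, v, t, _ => max 0 (v * t)
  | n + 1, v, t, x => max 0 (v * x 0 + peak n (-v) (t - x 0) (Fin.tail x))

/-- The waiting times `x 0, x 1, …` lead to exactly `n` arrivals up to time `t`. -/
def Straddles : (n : ℕ) → ℝ → (Fin (n + 1) → ℝ) → Prop
  | 0, t, x => t < x 0
  | n + 1, t, x => x 0 ≤ t ∧ Straddles n (t - x 0) (Fin.tail x)

lemma peak_nonneg (n : ℕ) (v t : ℝ) (x : Fin (n + 1) → ℝ) : 0 ≤ peak n v t x := by
  cases n <;> exact le_max_left _ _

lemma peak_const_mul {c : ℝ} (hc : 0 ≤ c) (n : ℕ) (v t : ℝ) (x : Fin (n + 1) → ℝ) :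
    peak n (c * v) t x = c * peak n v t x := by
  induction n generalizing v t with
  | zero => simp only [peak]; rw [mul_max_of_nonneg _ _ hc, mul_zero, mul_assoc]
  | succ n ih =>
    simp only [peak]
    rw [mul_max_of_nonneg _ _ hc, mul_zero, ← mul_neg, ih, mul_add, mul_assoc]

@[fun_prop]
lemma measurable_fin_tail (n : ℕ) :
    Measurable (fun x : Fin (n + 1) → ℝ => Fin.tail x) :=
  measurable_pi_lambda _ fun i => measurable_pi_apply i.succ

/-- Velocity and time vary with the parameter because the recursion replaces them by `-v` and `t - x
0`. -/
lemma measurable_peak (n : ℕ) {α : Type*} [MeasurableSpace α] {v t : α → ℝ}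
    {x : α → Fin (n + 1) → ℝ} (hv : Measurable v) (ht : Measurable t) (hx : Measurable x) :
    Measurable fun a => peak n (v a) (t a) (x a) := by
  induction n generalizing v t with
  | zero => simp only [peak]; fun_prop
  | succ n ih =>
    have h0 : Measurable fun a => x a 0 := measurable_pi_iff.1 hx 0
    have := ih hv.neg (ht.sub h0) ((measurable_fin_tail _).comp hx)
    exact measurable_const.max ((hv.mul h0).add this)

lemma measurableSet_straddles (n : ℕ) {α : Type*} [MeasurableSpace α] {t : α → ℝ}
    {x : α → Fin (n + 1) → ℝ} (ht : Measurable t) (hx : Measurable x) :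
    MeasurableSet {a | Straddles n (t a) (x a)} := by
  induction n generalizing t with
  | zero => exact measurableSet_lt ht (measurable_pi_iff.1 hx 0)
  | succ n ih =>
    have h0 : Measurable fun a => x a 0 := measurable_pi_iff.1 hx 0
    exact (measurableSet_le h0 ht).inter (ih (ht.sub h0) ((measurable_fin_tail _).comp hx))

/-! ### Renewal equation for exponential waiting times -/

/-- The law of `n + 1` independent exponential waiting times. -/
noncomputable def waitingLaw (lam : ℝ) (n : ℕ) : Measure (Fin (n + 1) → ℝ) :=
  Measure.pi fun _ => expMeasure lam

lemma expMeasure_eq_withDensity {lam : ℝ} :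
    expMeasure lam = volume.withDensity (exponentialPDF lam) := rfl

lemma expMeasure_Ioi {lam : ℝ} (hl : 0 < lam) {t : ℝ} (ht : 0 ≤ t) :
    expMeasure lam (Ioi t) = ENNReal.ofReal (Real.exp (-(lam * t))) := by
  have := isProbabilityMeasure_expMeasure hl
  rw [← compl_Iic, prob_compl_eq_one_sub measurableSet_Iic, expMeasure_eq_withDensity,
    withDensity_apply _ measurableSet_Iic, lintegral_exponentialPDF_eq_antiDeriv hl, if_pos ht,
    ← ENNReal.ofReal_one, ← ENNReal.ofReal_sub _ (by simp; positivity)]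
  simp

/-- Conditioning on the first waiting time. -/
lemma waitingLaw_first_step {lam : ℝ} (hl : 0 < lam) (n : ℕ) (t : ℝ)
    (B : Set (ℝ × (Fin (n + 1) → ℝ))) (hB : MeasurableSet B) :
    waitingLaw lam (n + 1) {x | x 0 ≤ t ∧ (x 0, Fin.tail x) ∈ B}
      = ∫⁻ y in Icc 0 t, ENNReal.ofReal (lam * Real.exp (-(lam * y)))
          * waitingLaw lam n {z | (y, z) ∈ B} := by
  have := isProbabilityMeasure_expMeasure hl
  have hmp := measurePreserving_piFinSuccAbove (fun _ : Fin (n + 2) => expMeasure lam) 0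
  have hE : MeasurableSet (B ∩ Prod.fst ⁻¹' Iic t) := hB.inter (measurable_fst measurableSet_Iic)
  have h1 := hmp.measure_preimage hE.nullMeasurableSet
  have h2 : {x : Fin (n + 2) → ℝ | x 0 ≤ t ∧ (x 0, Fin.tail x) ∈ B}
      = (MeasurableEquiv.piFinSuccAbove (fun _ => ℝ) 0) ⁻¹' (B ∩ Prod.fst ⁻¹' Iic t) := by
    ext x
    exact and_comm
  rw [waitingLaw, h2, h1, Measure.prod_apply hE, expMeasure_eq_withDensity,
    lintegral_withDensity_eq_lintegral_mul₀]
  · rw [← lintegral_indicator measurableSet_Icc]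
    refine lintegral_congr fun y => ?_
    by_cases hy : y ∈ Icc 0 t
    · rw [indicator_of_mem hy, Pi.mul_apply, exponentialPDF_of_nonneg hy.1]
      congr 2
      ext z; exact ⟨fun h => h.1, fun h => ⟨h, hy.2⟩⟩
    · rw [indicator_of_notMem hy, Pi.mul_apply]
      by_cases h0 : y < 0
      · rw [exponentialPDF_of_neg h0, zero_mul]
      · have : Prod.mk y ⁻¹' (B ∩ Prod.fst ⁻¹' Iic t) = ∅ := by
          ext z
          simp only [mem_preimage, mem_inter_iff, mem_Iic, mem_empty_iff_false, iff_false, not_and]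
          exact fun _ h => hy ⟨not_lt.1 h0, h⟩
        rw [this, measure_empty, mul_zero]
  · exact (measurable_exponentialPDFReal lam).ennreal_ofReal.aemeasurable
  · rw [← expMeasure_eq_withDensity]
    exact (measurable_measure_prodMk_left hE).aemeasurable

lemma setLIntegral_Icc_ofReal {f : ℝ → ℝ} (hf : Continuous f) {a b : ℝ} (hab : a ≤ b)
    (h0 : ∀ y ∈ Icc a b, 0 ≤ f y) :
    ∫⁻ y in Icc a b, ENNReal.ofReal (f y) = ENNReal.ofReal (∫ y in a..b, f y) := by
  rw [intervalIntegral.integral_of_le hab, ← integral_Icc_eq_integral_Ioc,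
    ofReal_integral_eq_lintegral_ofReal hf.integrableOn_Icc]
  exact (ae_restrict_iff' measurableSet_Icc).2 (ae_of_all _ h0)

lemma exp_step {lam : ℝ} (n : ℕ) (t y g : ℝ) (hl : 0 < lam) :
    ENNReal.ofReal (lam * Real.exp (-(lam * y)))
        * ENNReal.ofReal (lam ^ n * Real.exp (-(lam * (t - y))) * g)
      = ENNReal.ofReal (lam ^ (n + 1) * Real.exp (-(lam * t)) * g) := by
  rw [← ENNReal.ofReal_mul (by positivity)]
  congr 1
  rw [show -(lam * t) = -(lam * y) + -(lam * (t - y)) by ring, Real.exp_add]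
  ring

/-- The number of arrivals has the Poisson distribution. -/
lemma waitingLaw_straddles {lam : ℝ} (hl : 0 < lam) (n : ℕ) {t : ℝ} (ht : 0 ≤ t) :
    waitingLaw lam n {x | Straddles n t x}
      = ENNReal.ofReal (lam ^ n * Real.exp (-(lam * t)) * (t ^ n / n.factorial)) := by
  have := isProbabilityMeasure_expMeasure hl
  induction n generalizing t with
  | zero =>
    have h := (measurePreserving_eval (fun _ : Fin 1 => expMeasure lam) 0).measure_preimage
      (measurableSet_Ioi (a := t)).nullMeasurableSet
    rw [expMeasure_Ioi hl ht] at h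
    simp only [pow_zero, one_mul, Nat.factorial_zero, Nat.cast_one, div_one, mul_one]
    exact h
  | succ n ih =>
    have hB : MeasurableSet {z : ℝ × (Fin (n + 1) → ℝ) | Straddles n (t - z.1) z.2} :=
      measurableSet_straddles n (by fun_prop) measurable_snd
    have h := waitingLaw_first_step hl n t _ hB
    refine h.trans ?_
    simp only [mem_ofPred_eq]
    rw [setLIntegral_congr_fun measurableSet_Icc
      (g := fun y => ENNReal.ofReal
        (lam ^ (n + 1) * Real.exp (-(lam * t)) * ((t - y) ^ n / n.factorial)))
      (fun y hy => by simp only; rw [ih (sub_nonneg.2 hy.2), exp_step _ _ _ _ hl]),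
      setLIntegral_Icc_ofReal (by fun_prop) ht, intervalIntegral.integral_const_mul,
      integral_sub_pow_div_factorial, sub_zero]
    intro y hy
    have : 0 ≤ t - y := sub_nonneg.2 hy.2
    positivity

/-- The initial velocity `1` or `-1`. -/
def directionSign (right : Bool) : ℝ := if right then 1 else -1

lemma measurableSet_exceed (n : ℕ) (v t b : ℝ) :
    MeasurableSet {x : Fin (n + 1) → ℝ | Straddles n t x ∧ b < peak n v t x} :=
  (measurableSet_straddles n measurable_const measurable_id).inter
    (measurableSet_lt measurable_const (measurable_peak n measurable_const measurable_const
      measurable_id))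

/-- As `b ≥ 0`, the value `0` in the maximum never exceeds the level, so only the path after the
first reversal matters. -/
lemma waitingLaw_exceed_succ {lam : ℝ} (hl : 0 < lam) (n : ℕ) (v t : ℝ) {b : ℝ} (hb : 0 ≤ b) :
    waitingLaw lam (n + 1) {x | Straddles (n + 1) t x ∧ b < peak (n + 1) v t x}
      = ∫⁻ y in Icc 0 t, ENNReal.ofReal (lam * Real.exp (-(lam * y)))
          * waitingLaw lam n {z | Straddles n (t - y) z ∧ b - v * y < peak n (-v) (t - y) z} := by
  have hB : MeasurableSet {z : ℝ × (Fin (n + 1) → ℝ) |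
      Straddles n (t - z.1) z.2 ∧ b - v * z.1 < peak n (-v) (t - z.1) z.2} :=
    (measurableSet_straddles n (by fun_prop) measurable_snd).inter
      (measurableSet_lt (by fun_prop) (measurable_peak n measurable_const (by fun_prop)
        measurable_snd))
  refine Eq.trans ?_ (waitingLaw_first_step hl n t _ hB)
  congr 1
  ext x
  simp only [Straddles, peak, mem_ofPred_eq, lt_max_iff, not_lt.2 hb, false_or,
    sub_lt_iff_lt_add', and_assoc]

/-- The telegraph path cannot exceed level `b` at speed `1` before time `b`. -/
lemma waitingLaw_exceed_of_le {lam : ℝ} (hl : 0 < lam) (r : Bool) (n : ℕ) {t b : ℝ} (ht : 0 ≤ t)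
    (hb : t ≤ b) :
    waitingLaw lam n {x | Straddles n t x ∧ b < peak n (directionSign r) t x} = 0 := by
  induction n generalizing t b r with
  | zero =>
    refine measure_mono_null (t := ∅) (fun x hx => ?_) measure_empty
    refine absurd hx.2 (not_lt.2 (max_le (ht.trans hb) ?_))
    cases r <;> simp [directionSign] <;> linarith
  | succ n ih =>
    rw [waitingLaw_exceed_succ hl n _ t (ht.trans hb), setLIntegral_congr_fun measurableSet_Icc
      (g := fun _ => 0), lintegral_zero]
    intro y hy
    simp only
    have hs : -directionSign r = directionSign (!r) := by cases r <;> simp [directionSign]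
    rw [hs, ih _ (sub_nonneg.2 hy.2), mul_zero]
    have := hy.1
    cases r <;> simp [directionSign] <;> linarith

/-- The joint distribution of the number of arrivals and of the maximum of the path. -/
lemma waitingLaw_exceed {lam : ℝ} (hl : 0 < lam) (r : Bool) (n : ℕ) {t b : ℝ} (hb : 0 ≤ b)
    (hbt : b < t) :
    waitingLaw lam n {x | Straddles n t x ∧ b < peak n (directionSign r) t x}
      = ENNReal.ofReal (lam ^ n * Real.exp (-(lam * t))
          * exceedVolume r n ((t + b) / 2) ((t - b) / 2)) := by
  induction n generalizing t b r with
  | zero =>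
    cases r with
    | false =>
      have : {x : Fin 1 → ℝ | Straddles 0 t x ∧ b < peak 0 (directionSign false) t x} = ∅ := by
        ext x
        simp only [peak, mem_ofPred_eq, mem_empty_iff_false, iff_false, not_and, not_lt, directionSign]
        intro _
        refine max_le hb ?_
        simp; linarith
      rw [this]
      simp [exceedVolume, partialBinomial]
    | true =>
      have : {x : Fin 1 → ℝ | Straddles 0 t x ∧ b < peak 0 (directionSign true) t x}
          = {x : Fin 1 → ℝ | Straddles 0 t x} := by
        ext x
        simp [peak, directionSign, hbt]
      rw [this, waitingLaw_straddles hl 0 (hb.trans hbt.le)]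
      simp [exceedVolume, partialBinomial]
  | succ n ih =>
    rw [waitingLaw_exceed_succ hl n _ t hb]
    set K := lam ^ (n + 1) * Real.exp (-(lam * t)) with hK
    have hK0 : 0 ≤ K := by positivity
    cases r with
    | false =>
      -- At `y = (t - b) / 2` the remaining time `t - y` equals the height `b + y` still to be
      -- climbed; later reversals contribute nothing.
      have hm : Icc 0 t = Ico 0 ((t - b) / 2) ∪ Icc ((t - b) / 2) t :=
        (Ico_union_Icc_eq_Icc (by linarith) (by linarith)).symm
      have hdisj : Disjoint (Ico 0 ((t - b) / 2)) (Icc ((t - b) / 2) t) :=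
        disjoint_left.2 fun y h1 h2 => absurd h1.2 (not_lt.2 h2.1)
      have hz : ∀ y ∈ Icc ((t - b) / 2) t, waitingLaw lam n {z | Straddles n (t - y) z ∧
          b - directionSign false * y < peak n (-directionSign false) (t - y) z} = 0 := by
        intro y hy
        have := waitingLaw_exceed_of_le hl true n (t := t - y) (b := b + y) (by linarith [hy.2])
          (by linarith [hy.1])
        simpa [directionSign] using this
      have hi : ∀ y ∈ Ico 0 ((t - b) / 2), waitingLaw lam n {z | Straddles n (t - y) z ∧
          b - directionSign false * y < peak n (-directionSign false) (t - y) z}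
          = ENNReal.ofReal (lam ^ n * Real.exp (-(lam * (t - y)))
            * exceedVolume true n ((t + b) / 2) ((t - b) / 2 - y)) := by
        intro y hy
        have := ih true (t := t - y) (b := b + y) (by linarith [hy.1]) (by linarith [hy.2])
        rw [show (t - y + (b + y)) / 2 = (t + b) / 2 by ring,
          show (t - y - (b + y)) / 2 = (t - b) / 2 - y by ring] at this
        simpa [directionSign] using this
      rw [hm, lintegral_union measurableSet_Icc hdisj,
        setLIntegral_congr_fun measurableSet_Icc (g := fun _ => 0)
          (fun y hy => by simp only; rw [hz y hy, mul_zero]), lintegral_zero, add_zero,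
        setLIntegral_congr_fun measurableSet_Ico
          (fun y hy => (congrArg (ENNReal.ofReal (lam * Real.exp (-(lam * y))) * ·)
            (hi y hy)).trans (exp_step _ _ _ _ hl)),
        Measure.restrict_congr_set Ico_ae_eq_Icc, setLIntegral_Icc_ofReal _ (by linarith),
        intervalIntegral.integral_const_mul, integral_exceedVolume_true]
      · intro y hy
        exact mul_nonneg hK0 (exceedVolume_nonneg (by linarith) (by linarith [hy.2]))
      · exact continuous_const.mul ((continuous_exceedVolume true n).comp
          (f := fun y : ℝ => ((t + b) / 2, (t - b) / 2 - y)) (by fun_prop))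
    | true =>
      have hdisj : Disjoint (Icc 0 b) (Ioc b t) :=
        disjoint_left.2 fun y h1 h2 => absurd h1.2 (not_le.2 h2.1)
      -- The level is passed before the first reversal, so only the arrival count constrains the
      -- rest.
      have hz : ∀ y ∈ Ioc b t, waitingLaw lam n {z | Straddles n (t - y) z ∧
          b - directionSign true * y < peak n (-directionSign true) (t - y) z}
          = ENNReal.ofReal (lam ^ n * Real.exp (-(lam * (t - y)))
            * ((t - y) ^ n / n.factorial)) := by
        intro y hy
        rw [← waitingLaw_straddles hl n (sub_nonneg.2 hy.2)]
        congr 1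
        ext z
        refine and_iff_left (lt_of_lt_of_le ?_ (peak_nonneg _ _ _ _))
        simp only [directionSign, if_true]; linarith [hy.1]
      have hi : ∀ y ∈ Icc 0 b, waitingLaw lam n {z | Straddles n (t - y) z ∧
          b - directionSign true * y < peak n (-directionSign true) (t - y) z}
          = ENNReal.ofReal (lam ^ n * Real.exp (-(lam * (t - y)))
            * exceedVolume false n ((t + b) / 2 - y) ((t - b) / 2)) := by
        intro y hy
        have := ih false (t := t - y) (b := b - y) (by linarith [hy.2]) (by linarith)
        rw [show (t - y + (b - y)) / 2 = (t + b) / 2 - y by ring,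
          show (t - y - (b - y)) / 2 = (t - b) / 2 by ring] at this
        simpa [directionSign] using this
      have hint : ∫ y in (0 : ℝ)..b, exceedVolume false n ((t + b) / 2 - y) ((t - b) / 2)
          = exceedVolume true (n + 1) ((t + b) / 2) ((t - b) / 2)
            - (t - b) ^ (n + 1) / (n + 1).factorial := by
        have h := integral_exceedVolume_false n ((t + b) / 2) ((t - b) / 2)
        rwa [show (t + b) / 2 - (t - b) / 2 = b by ring,
          show 2 * ((t - b) / 2) = t - b by ring] at h
      have hn1 : ∀ y ∈ Icc 0 b,
          0 ≤ K * exceedVolume false n ((t + b) / 2 - y) ((t - b) / 2) := fun y hy =>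
        mul_nonneg hK0 (exceedVolume_nonneg (by linarith [hy.2]) (by linarith))
      have hn2 : ∀ y ∈ Icc b t, 0 ≤ K * ((t - y) ^ n / n.factorial) := fun y hy => by
        have : 0 ≤ t - y := sub_nonneg.2 hy.2
        positivity
      rw [← Icc_union_Ioc_eq_Icc hb hbt.le, lintegral_union measurableSet_Ioc hdisj,
        setLIntegral_congr_fun measurableSet_Ioc
          (fun y hy => (congrArg (ENNReal.ofReal (lam * Real.exp (-(lam * y))) * ·)
            (hz y hy)).trans (exp_step _ _ _ _ hl)),
        setLIntegral_congr_fun measurableSet_Icc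
          (fun y hy => (congrArg (ENNReal.ofReal (lam * Real.exp (-(lam * y))) * ·)
            (hi y hy)).trans (exp_step _ _ _ _ hl)),
        Measure.restrict_congr_set Ioc_ae_eq_Icc, setLIntegral_Icc_ofReal _ hb hn1,
        setLIntegral_Icc_ofReal (by fun_prop) hbt.le hn2,
        ← ENNReal.ofReal_add (intervalIntegral.integral_nonneg hb hn1)
          (intervalIntegral.integral_nonneg hbt.le hn2),
        intervalIntegral.integral_const_mul, intervalIntegral.integral_const_mul, hint,
        integral_sub_pow_div_factorial]
      · congr 1; ring
      · exact continuous_const.mul ((continuous_exceedVolume false n).comp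
          (f := fun y : ℝ => ((t + b) / 2 - y, (t - b) / 2)) (by fun_prop))

/-! ### Counting paths and their velocity integrals -/

/-- The number of arrivals up to time `u`, for the waiting times `x`. -/
noncomputable def arrivals (x : ℕ → ℝ) (u : ℝ) : ℕ :=
  {n : ℕ | ∑ i ∈ Finset.range (n + 1), x i ≤ u}.ncard

/-- Positive waiting times without explosion. -/
structure IsWaitingTimes (x : ℕ → ℝ) : Prop where
  pos : ∀ i, 0 < x i
  tendsto : Filter.Tendsto (fun n => ∑ i ∈ Finset.range n, x i) Filter.atTop Filter.atTop

namespace IsWaitingTimes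

variable {x : ℕ → ℝ}

lemma tail (hx : IsWaitingTimes x) : IsWaitingTimes fun i => x (i + 1) := by
  refine ⟨fun i => hx.pos _, ?_⟩
  have h := Filter.tendsto_atTop_add_const_right _ (-x 0)
    ((Filter.tendsto_add_atTop_iff_nat 1).2 hx.tendsto)
  simpa [Finset.sum_range_succ'] using h

lemma finite (hx : IsWaitingTimes x) (u : ℝ) :
    {n : ℕ | ∑ i ∈ Finset.range (n + 1), x i ≤ u}.Finite := by
  have h := ((Filter.tendsto_add_atTop_iff_nat 1).2 hx.tendsto).eventually_gt_atTop u
  obtain ⟨m, hm⟩ := Filter.eventually_atTop.1 h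
  refine (finite_Iio m).subset fun n hn => ?_
  by_contra hmn
  exact absurd hn (not_le.2 (hm n (not_lt.1 hmn)))

lemma strictMono (hx : IsWaitingTimes x) :
    StrictMono fun n => ∑ i ∈ Finset.range (n + 1), x i :=
  strictMono_nat_of_lt_succ fun n => by
    rw [Finset.sum_range_succ _ (n + 1)]; linarith [hx.pos (n + 1)]

lemma monotone_arrivals (hx : IsWaitingTimes x) : Monotone (arrivals x) := fun _ w huw =>
  ncard_le_ncard (fun _ hn => le_trans hn huw) (hx.finite w)

/-- Arrival times increase strictly, so the counted indices form a finite initial segment. -/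
lemma arrivals_le_iff (hx : IsWaitingTimes x) (u : ℝ) (i : ℕ) :
    arrivals x u ≤ i ↔ u < ∑ j ∈ Finset.range (i + 1), x j := by
  constructor
  · intro h
    by_contra hu
    have hsub : Iic i ⊆ {n : ℕ | ∑ i ∈ Finset.range (n + 1), x i ≤ u} := fun n hn =>
      (hx.strictMono.monotone hn).trans (not_lt.1 hu)
    have := ncard_le_ncard hsub (hx.finite u)
    rw [← Finset.coe_Iic, ncard_coe_finset, Nat.card_Iic] at this
    exact absurd h (by unfold arrivals; omega)
  · intro h
    have hsub : {n : ℕ | ∑ i ∈ Finset.range (n + 1), x i ≤ u} ⊆ Iio i := fun n hn => by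
      by_contra hin
      exact absurd (h.trans_le (hx.strictMono.monotone (not_lt.1 hin))) (not_lt.2 hn)
    have := ncard_le_ncard hsub (finite_Iio i)
    rwa [← Finset.coe_Iio, ncard_coe_finset, Nat.card_Iio] at this

lemma arrivals_of_lt (hx : IsWaitingTimes x) {u : ℝ} (hu : u < x 0) : arrivals x u = 0 :=
  Nat.le_zero.1 ((hx.arrivals_le_iff u 0).2 (by simpa using hu))

lemma arrivals_add (hx : IsWaitingTimes x) {u : ℝ} (hu : 0 ≤ u) :
    arrivals x (x 0 + u) = arrivals (fun i => x (i + 1)) u + 1 := by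
  refine eq_of_forall_ge_iff fun i => ?_
  cases i with
  | zero => rw [hx.arrivals_le_iff]; simp [hu]
  | succ i =>
    rw [hx.arrivals_le_iff, Nat.add_le_add_iff_right, hx.tail.arrivals_le_iff,
      Finset.sum_range_succ']
    constructor <;> intro h <;> linarith

lemma arrivals_eq_iff (hx : IsWaitingTimes x) (n : ℕ) {t : ℝ} (ht : 0 ≤ t) :
    arrivals x t = n ↔ Straddles n t (fun i => x i) := by
  induction n generalizing x t with
  | zero => rw [← Nat.le_zero, hx.arrivals_le_iff]; simp [Straddles]
  | succ n ih =>
    by_cases h : x 0 ≤ t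
    · have h1 := hx.arrivals_add (sub_nonneg.2 h)
      rw [add_sub_cancel] at h1
      rw [h1, Nat.add_right_cancel_iff, ih hx.tail (sub_nonneg.2 h)]
      exact (and_iff_right h).symm
    · rw [hx.arrivals_of_lt (not_le.1 h)]
      exact iff_of_false (Nat.succ_ne_zero n).symm fun h' => h h'.1

lemma intervalIntegrable (hx : IsWaitingTimes x) (v a b : ℝ) :
    IntervalIntegrable (fun u => v * (-1) ^ arrivals x u) volume a b := by
  have hm : Measurable fun u => v * (-1 : ℝ) ^ arrivals x u :=
    measurable_const.mul ((measurable_from_top (f := fun n : ℕ => (-1 : ℝ) ^ n)).comp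
      hx.monotone_arrivals.measurable)
  refine (intervalIntegrable_const (c := |v|)).mono_fun hm.aestronglyMeasurable ?_
  exact ae_of_all _ fun u => by simp

lemma integral_of_le (hx : IsWaitingTimes x) (v : ℝ) {s : ℝ} (h0 : 0 ≤ s) (hs : s ≤ x 0) :
    ∫ u in (0 : ℝ)..s, v * (-1) ^ arrivals x u = v * s := by
  have : ∫ u in (0 : ℝ)..s, v * (-1) ^ arrivals x u = ∫ u in (0 : ℝ)..s, v := by
    rw [intervalIntegral.integral_of_le h0, intervalIntegral.integral_of_le h0,
      -- The endpoint is dropped because at `u = x 0` the velocity has already reversed.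
      integral_Ioc_eq_integral_Ioo, integral_Ioc_eq_integral_Ioo]
    refine setIntegral_congr_fun measurableSet_Ioo fun u hu => ?_
    simp [hx.arrivals_of_lt (hu.2.trans_le hs)]
  rw [this]; simp [mul_comm]

lemma integral_add (hx : IsWaitingTimes x) (v : ℝ) {s : ℝ} (h0 : 0 ≤ s) :
    ∫ u in (0 : ℝ)..(x 0 + s), v * (-1) ^ arrivals x u
      = v * x 0 + ∫ u in (0 : ℝ)..s, -v * (-1) ^ arrivals (fun i => x (i + 1)) u := by
  rw [← intervalIntegral.integral_add_adjacent_intervals (hx.intervalIntegrable v 0 (x 0))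
    (hx.intervalIntegrable v (x 0) (x 0 + s)), hx.integral_of_le v (hx.pos 0).le le_rfl]
  congr 1
  have h := intervalIntegral.integral_comp_add_left
    (fun u => v * (-1 : ℝ) ^ arrivals x u) (x 0) (a := 0) (b := s)
  rw [add_zero] at h
  rw [← h]
  refine intervalIntegral.integral_congr fun u hu => ?_
  rw [uIcc_of_le h0] at hu
  simp only [hx.arrivals_add hu.1]
  ring

end IsWaitingTimes

/-! ### The pathwise maximum -/

lemma isGreatest_image_const_mul (v : ℝ) {a : ℝ} (ha : 0 ≤ a) :
    IsGreatest ((fun s => v * s) '' Icc 0 a) (max 0 (v * a)) := by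
  constructor
  · rcases le_total 0 (v * a) with h | h
    · rw [max_eq_right h]; exact ⟨a, ⟨ha, le_rfl⟩, rfl⟩
    · rw [max_eq_left h]; exact ⟨0, ⟨le_rfl, ha⟩, by simp⟩
  · rintro _ ⟨s, hs, rfl⟩
    simp only
    rcases le_total 0 v with h | h
    · exact (mul_le_mul_of_nonneg_left hs.2 h).trans (le_max_right _ _)
    · exact (mul_nonpos_of_nonpos_of_nonneg h hs.1).trans (le_max_left _ _)

/-- The maximum of the path with initial velocity `v` and waiting times `x`. -/
lemma IsWaitingTimes.isGreatest_peak {x : ℕ → ℝ} (hx : IsWaitingTimes x) (n : ℕ) (v : ℝ) {t : ℝ}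
    (ht : 0 ≤ t) (hn : Straddles n t (fun i => x i)) :
    IsGreatest ((fun s => ∫ u in (0 : ℝ)..s, v * (-1) ^ arrivals x u) '' Icc 0 t)
      (peak n v t (fun i => x i)) := by
  induction n generalizing x v t with
  | zero =>
    have hn : t < x 0 := hn
    rw [image_congr fun s hs => hx.integral_of_le v hs.1 (hs.2.trans hn.le)]
    exact isGreatest_image_const_mul v ht
  | succ n ih =>
    have h0 : x 0 ≤ t := hn.1
    have hi := ih hx.tail (-v) (sub_nonneg.2 h0) hn.2
    have h2 : IsGreatest ((fun s => ∫ u in (0 : ℝ)..s, v * (-1) ^ arrivals x u) '' Icc (x 0) t)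
        (v * x 0 + peak n (-v) (t - x 0) (fun i => x (i + 1))) := by
      constructor
      · obtain ⟨s, hs, he⟩ := hi.1
        refine ⟨x 0 + s, ⟨by linarith [hs.1], by linarith [hs.2]⟩, ?_⟩
        simp only [hx.integral_add v hs.1]
        rw [← he]
      · rintro _ ⟨s, hs, rfl⟩
        have h := hi.2 (mem_image_of_mem _ (show s - x 0 ∈ Icc 0 (t - x 0) from
          ⟨by linarith [hs.1], by linarith [hs.2]⟩))
        have h' := hx.integral_add v (sub_nonneg.2 hs.1)
        rw [add_sub_cancel] at h'
        simp only [h']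
        linarith
    have h1 := isGreatest_image_const_mul v (hx.pos 0).le
    rw [← image_congr fun s hs => hx.integral_of_le v hs.1 hs.2] at h1
    have h3 := h1.union h2
    rw [← image_union, Icc_union_Icc_eq_Icc (hx.pos 0).le h0] at h3
    have h4 := peak_nonneg n (-v) (t - x 0) (fun i => x (i + 1))
    -- The height `v * x 0` at the first reversal is absorbed, since the remaining path has
    -- nonnegative peak; this leaves the recursive formula for `peak`.
    rw [max_assoc, max_eq_right (a := v * x 0) (by linarith)] at h3
    exact h3

/-! ### Laws of the waiting times and their recovery from the path -/

/-- Independent exponential waiting times are positive and do not explode. -/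
lemma ae_isWaitingTimes {Ω : Type*} [MeasurableSpace Ω] {P : Measure Ω} [IsProbabilityMeasure P]
    {lam : ℝ} (hl : 0 < lam) {X : ℕ → Ω → ℝ} (hm : ∀ i, Measurable (X i)) (hi : iIndepFun X P)
    (hX : ∀ i, P.map (X i) = expMeasure lam) : ∀ᵐ ω ∂P, IsWaitingTimes fun i => X i ω := by
  have hP : ∀ (i : ℕ) {a : ℝ}, 0 ≤ a →
      P (X i ⁻¹' Ioi a) = ENNReal.ofReal (Real.exp (-(lam * a))) := fun i a ha => by
    rw [← Measure.map_apply (hm i) measurableSet_Ioi, hX, expMeasure_Ioi hl ha]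
  have h1 : ∀ᵐ ω ∂P, ∀ i, 0 < X i ω := ae_all_iff.2 fun i => by
    have h : P (X i ⁻¹' Ioi 0) = 1 := by simpa using hP i le_rfl
    exact (mem_ae_iff_prob_eq_one (hm i measurableSet_Ioi)).2 h
  have hms : ∀ i, MeasurableSet (X i ⁻¹' Ioi 1) := fun i => hm i measurableSet_Ioi
  have hind : iIndepSet (fun i => X i ⁻¹' Ioi 1) P := by
    rw [iIndepSet_iff_meas_biInter hms]
    intro s
    exact hi.measure_inter_preimage_eq_mul s fun i _ => measurableSet_Ioi
  have hsum : ∑' i, P (X i ⁻¹' Ioi 1) = ∞ := by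
    simp_rw [hP _ zero_le_one]
    exact ENNReal.tsum_const_eq_top_of_ne_zero (by simpa using Real.exp_pos _)
  -- By the second Borel–Cantelli lemma, infinitely many waiting times exceed `1`, so their sum
  -- diverges.
  have h2 := measure_limsup_eq_one hms hind hsum
  have h3 : ∀ᵐ ω ∂P, ω ∈ Filter.limsup (fun i => X i ⁻¹' Ioi 1) Filter.atTop :=
    (mem_ae_iff_prob_eq_one (MeasurableSet.measurableSet_limsup hms)).2 h2
  filter_upwards [h1, h3] with ω hω hf
  refine ⟨hω, (not_summable_iff_tendsto_nat_atTop_of_nonneg fun i => (hω i).le).1 fun hs => ?_⟩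
  rw [Filter.mem_limsup_iff_frequently_mem] at hf
  obtain ⟨i, hi1, hi2⟩ := (hf.and_eventually
    (hs.tendsto_atTop_zero.eventually_lt_const zero_lt_one)).exists
  exact lt_asymm hi1 hi2

lemma map_waitingTimes {Ω : Type*} [MeasurableSpace Ω] {P : Measure Ω} [IsProbabilityMeasure P]
    {lam : ℝ} {X : ℕ → Ω → ℝ} (hm : ∀ i, Measurable (X i)) (hi : iIndepFun X P)
    (hX : ∀ i, P.map (X i) = expMeasure lam) (n : ℕ) :
    P.map (fun ω (i : Fin (n + 1)) => X i ω) = waitingLaw lam n := by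
  have h := (iIndepFun_iff_map_fun_eq_pi_map (fun i : Fin (n + 1) => (hm i).aemeasurable)).1
    (hi.precomp Fin.val_injective)
  simpa [hX, waitingLaw] using h

/-- The time of the `i`-th arrival (counted from `0`) of a counting path. -/
noncomputable def arrivalTime (i : ℕ) (w : ℝ≥0 → ℕ) : ℝ :=
  (⨆ q : ℚ, if w (Real.toNNReal q) ≤ i then (Real.toNNReal q : ℝ≥0∞) else 0).toReal

/-- The `i`-th waiting time of a counting path. -/
noncomputable def waitingTime (w : ℝ≥0 → ℕ) : ℕ → ℝ
  | 0 => arrivalTime 0 w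
  | i + 1 => arrivalTime (i + 1) w - arrivalTime i w

lemma measurable_arrivalTime (i : ℕ) : Measurable (arrivalTime i) := by
  refine (Measurable.iSup fun q => ?_).ennreal_toReal
  exact Measurable.ite (measurableSet_le (measurable_pi_apply _) measurable_const)
    measurable_const measurable_const

lemma measurable_waitingTime : Measurable waitingTime := by
  refine measurable_pi_lambda _ fun i => ?_
  cases i with
  | zero => exact measurable_arrivalTime 0
  | succ i => exact (measurable_arrivalTime (i + 1)).sub (measurable_arrivalTime i)

/-- The count is at most `i` exactly before the `i`-th arrival, and rational times suffice by
density; the countable supremum is what makes `arrivalTime` measurable. -/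
lemma IsWaitingTimes.arrivalTime_eq {x : ℕ → ℝ} (hx : IsWaitingTimes x) (i : ℕ) :
    arrivalTime i (fun u => arrivals x u) = ∑ j ∈ Finset.range (i + 1), x j := by
  have h0 : 0 ≤ ∑ j ∈ Finset.range (i + 1), x j := Finset.sum_nonneg fun j _ => (hx.pos j).le
  rw [arrivalTime, ← ENNReal.toReal_ofReal h0]
  congr 1
  refine le_antisymm (iSup_le fun q => ?_) (le_of_forall_lt fun a ha => ?_)
  · split_ifs with h
    · rw [hx.arrivals_le_iff] at h
      rw [ENNReal.ofReal, ENNReal.coe_le_coe]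
      exact (Real.le_toNNReal_iff_coe_le h0).2 h.le
    · exact zero_le
  · obtain ⟨q, _, haq, hq⟩ := ENNReal.lt_iff_exists_rat_btwn.1 ha
    refine lt_of_lt_of_le haq (le_iSup_of_le q ?_)
    rw [if_pos]
    rw [hx.arrivals_le_iff]
    rw [ENNReal.ofReal, ENNReal.coe_lt_coe] at hq
    exact Real.lt_toNNReal_iff_coe_lt.1 hq

lemma IsWaitingTimes.waitingTime_eq {x : ℕ → ℝ} (hx : IsWaitingTimes x) :
    waitingTime (fun u => arrivals x u) = x := by
  ext i
  cases i with
  | zero => simp [waitingTime, hx.arrivalTime_eq]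
  | succ i =>
    simp only [waitingTime, hx.arrivalTime_eq]
    rw [Finset.sum_range_succ _ (i + 1)]
    ring

/-! ### From tails to densities -/

/-- A measure on `ℝ` with differentiable tail has a density. -/
lemma isDensityOn_of_tail {μ : Measure ℝ} [IsFiniteMeasure μ] {L : ℝ} {T f : ℝ → ℝ}
    (hT : ∀ b, 0 ≤ b → b < L → μ (Ioi b) = ENNReal.ofReal (T b))
    (hT0 : ∀ b, 0 ≤ b → b < L → 0 ≤ T b)
    (hd : ∀ b, HasDerivAt T (-f b) b) (hf : Continuous f) (hf0 : ∀ b ∈ Ioo 0 L, 0 ≤ f b) :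
    IsDensityOn μ (Ioo 0 L) f := by
  refine ⟨hf.continuousOn, hf0, ?_⟩
  have hIoc : ∀ a b, 0 ≤ a → a ≤ b → b < L →
      μ (Ioc a b) = ∫⁻ x in Ioc a b, ENNReal.ofReal (f x) := by
    intro a b ha hab hb
    have h0 : ∀ᵐ x ∂volume.restrict (Ioc a b), 0 ≤ f x :=
      (ae_restrict_iff' measurableSet_Ioc).2 (ae_of_all _ fun x hx =>
        hf0 x ⟨ha.trans_lt hx.1, hx.2.trans_lt hb⟩)
    rw [← ofReal_integral_eq_lintegral_ofReal hf.integrableOn_Ioc h0,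
      ← intervalIntegral.integral_of_le hab]
    have hi : ∫ x in a..b, f x = T a - T b := by
      have := intervalIntegral.integral_eq_sub_of_hasDerivAt (a := a) (b := b) (f := fun x => -T x)
        (fun x _ => (hd x).neg) (by simpa using hf.intervalIntegrable a b)
      simp only [neg_neg] at this
      rw [this]; ring
    rw [hi, ENNReal.ofReal_sub _ (hT0 b (ha.trans hab) hb), ← hT a ha (hab.trans_lt hb),
      ← hT b (ha.trans hab) hb, ← measure_sdiff (Ioi_subset_Ioi hab)
        measurableSet_Ioi.nullMeasurableSet (measure_ne_top _ _), Ioi_sdiff_Ioi]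
  rw [← restrict_withDensity measurableSet_Ioo]
  -- The tail is known only below `L`, so the interval is exhausted by `Ioc 0 (u k)` with `u k`
  -- increasing to `L`.
  obtain ⟨u, -, hu, hut⟩ := exists_seq_strictMono_tendsto L
  have hcover : Ioo 0 L = ⋃ k, Ioc 0 (u k) := by
    ext x
    simp only [mem_Ioo, mem_iUnion, mem_Ioc]
    refine ⟨fun hx => ?_, fun ⟨k, hk⟩ => ⟨hk.1, hk.2.trans_lt (hu k)⟩⟩
    obtain ⟨k, hk⟩ := (hut.eventually_const_lt hx.2).exists
    exact ⟨k, hx.1, hk.le⟩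
  rw [hcover, Measure.restrict_iUnion_congr]
  intro k
  refine Measure.ext_of_Ioc _ _ fun x y _ => ?_
  rw [Measure.restrict_apply measurableSet_Ioc, Measure.restrict_apply measurableSet_Ioc,
    Ioc_inter_Ioc]
  rcases le_or_gt (x ⊔ 0) (y ⊓ u k) with h | h
  · rw [hIoc _ _ le_sup_right h (inf_le_right.trans_lt (hu k)),
      withDensity_apply _ measurableSet_Ioc]
  · rw [Ioc_eq_empty (not_lt.2 h.le), measure_empty, measure_empty]

/-! ### Conditional laws for the telegraph process -/

lemma isGreatest_telegraph {Ω : Type*} {V : Ω → ℝ} {N : ℝ≥0 → Ω → ℕ} {x : ℕ → ℝ}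
    (hx : IsWaitingTimes x)
    {ω : Ω} (hN : ∀ s : ℝ≥0, N s ω = arrivals x s) {t : ℝ} (ht : 0 ≤ t) :
    IsGreatest ((fun s => telegraph V N s ω) '' Icc 0 t)
      (peak (N t.toNNReal ω) (V ω) t (fun i => x i)) := by
  have hNt : arrivals x t = N t.toNNReal ω := by rw [hN, Real.coe_toNNReal t ht]
  have h := hx.isGreatest_peak _ (V ω) ht ((hx.arrivals_eq_iff _ ht).1 hNt)
  rwa [image_congr (g := fun s => telegraph V N s ω)] at h
  intro s hs
  refine intervalIntegral.integral_congr fun u hu => ?_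
  rw [uIcc_of_le hs.1] at hu
  rw [hN, Real.coe_toNNReal u hu.1]

section

variable {Ω : Type*} [MeasurableSpace Ω] {P : Measure Ω}
  {c lam : ℝ} {V : Ω → ℝ} {N : ℝ≥0 → Ω → ℕ}

lemma ae_telegraphMax {X : ℕ → Ω → ℝ}
    (hX : ∀ᵐ ω ∂P, IsWaitingTimes (fun i => X i ω) ∧
        ∀ s : ℝ≥0, N s ω = arrivals (fun i => X i ω) s) {t : ℝ} (ht : 0 ≤ t) :
    ∀ᵐ ω ∂P, IsGreatest ((fun s => telegraph V N s ω) '' Icc 0 t) (telegraphMax V N t ω) ∧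
      telegraphMax V N t ω = peak (N t.toNNReal ω) (V ω) t (fun i => X i ω) ∧
      ∀ n, N t.toNNReal ω = n ↔ Straddles n t (fun i => X i ω) := by
  filter_upwards [hX] with ω hω
  have h := isGreatest_telegraph (V := V) hω.1 hω.2 ht
  have he : telegraphMax V N t ω = peak (N t.toNNReal ω) (V ω) t (fun i => X i ω) := h.csSup_eq
  refine ⟨he ▸ h, he, fun n => ?_⟩
  rw [hω.2, Real.coe_toNNReal t ht, hω.1.arrivals_eq_iff n ht]

lemma IsTelegraphData.prob_sign (hT : IsTelegraphData P c lam V N) (r : Bool) :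
    P (V ⁻¹' {c * directionSign r}) = 1 / 2 := by
  cases r
  · rw [show c * directionSign false = -c by simp [directionSign]]; exact hT.prob_left
  · rw [show c * directionSign true = c by simp [directionSign]]; exact hT.prob_right

lemma measurableSet_cond (hT : IsTelegraphData P c lam V N) (t v : ℝ) (n : ℕ) :
    MeasurableSet {ω | V ω = v ∧ N t.toNNReal ω = n} :=
  (hT.measurable_velocity (measurableSet_singleton v)).inter
    (hT.poisson.measurable _ (measurableSet_singleton n))

variable [IsProbabilityMeasure P]

/-- Waiting times of the Poisson process that are independent of the initial velocity. -/
lemma IsTelegraphData.exists_waitingTimes (hT : IsTelegraphData P c lam V N) :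
    ∃ X : ℕ → Ω → ℝ, (∀ i, Measurable (X i)) ∧
      (∀ n, P.map (fun ω (i : Fin (n + 1)) => X i ω) = waitingLaw lam n) ∧
      IndepFun V (fun ω i => X i ω) P ∧
      ∀ᵐ ω ∂P, IsWaitingTimes (fun i => X i ω) ∧
        ∀ s : ℝ≥0, N s ω = arrivals (fun i => X i ω) s := by
  obtain ⟨X, hm, hi, hX, hN⟩ := hT.poisson.exists_interarrival
  have hae := (ae_isWaitingTimes hT.poisson.rate_pos hm hi hX).and hN
  refine ⟨X, hm, map_waitingTimes hm hi hX, ?_, hae⟩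
  -- The given interarrival times are not assumed independent of `V`; they agree almost surely with
  -- `waitingTime` of the path of `N`, which is.
  refine (hT.indep.comp measurable_id measurable_waitingTime).congr (ae_eq_refl _) ?_
  filter_upwards [hae] with ω hω
  have h : (fun s : ℝ≥0 => N s ω) = fun s : ℝ≥0 => arrivals (fun i => X i ω) s := funext hω.2
  simp only [Function.comp]
  rw [h, hω.1.waitingTime_eq]

lemma aemeasurable_telegraphMax (hT : IsTelegraphData P c lam V N) {t : ℝ} (ht : 0 ≤ t) :
    AEMeasurable (telegraphMax V N t) P := by
  obtain ⟨X, hm, -, -, hX⟩ := hT.exists_waitingTimes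
  refine ⟨fun ω => peak (N t.toNNReal ω) (V ω) t (fun i => X i ω), ?_, ?_⟩
  · have h : Measurable fun z : ℕ × Ω => peak z.1 (V z.2) t (fun i => X i z.2) :=
      measurable_from_prod_countable_right fun n => measurable_peak n hT.measurable_velocity
        measurable_const (measurable_pi_lambda _ fun i => hm i)
    exact h.comp ((hT.poisson.measurable _).prodMk measurable_id)
  · filter_upwards [ae_telegraphMax (V := V) hX ht] with ω hω using hω.2.1

lemma prob_cond (hT : IsTelegraphData P c lam V N) {t : ℝ} (ht : 0 ≤ t) (r : Bool) (n : ℕ) :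
    P {ω | V ω = c * directionSign r ∧ N t.toNNReal ω = n}
      = 1 / 2 * ENNReal.ofReal (lam ^ n * Real.exp (-(lam * t)) * (t ^ n / n.factorial)) := by
  obtain ⟨X, hm, hlaw, hind, hX⟩ := hT.exists_waitingTimes
  have hmY : Measurable fun ω (i : Fin (n + 1)) => X i ω := measurable_pi_lambda _ fun i => hm i
  have hE : MeasurableSet {x : Fin (n + 1) → ℝ | Straddles n t x} :=
    measurableSet_straddles n measurable_const measurable_id
  have hrest : Measurable fun (x : ℕ → ℝ) (i : Fin (n + 1)) => x i := by fun_prop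
  have h := (hind.comp measurable_id hrest).measure_inter_preimage_eq_mul _ _
    (measurableSet_singleton (c * directionSign r)) hE
  rw [← waitingLaw_straddles hT.poisson.rate_pos n ht, ← hT.prob_sign r, ← hlaw n,
    Measure.map_apply hmY hE]
  refine Eq.trans (measure_congr ?_) h
  filter_upwards [ae_telegraphMax (V := V) hX ht] with ω hω
  exact propext (and_congr Iff.rfl (hω.2.2 n))

lemma prob_exceed (hT : IsTelegraphData P c lam V N) {t b : ℝ} (hb : 0 ≤ b) (hbt : b < c * t)
    (r : Bool) (n : ℕ) :
    P ({ω | V ω = c * directionSign r ∧ N t.toNNReal ω = n} ∩ telegraphMax V N t ⁻¹' Ioi b)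
      = 1 / 2 * ENNReal.ofReal (lam ^ n * Real.exp (-(lam * t))
          * exceedVolume r n ((t + b / c) / 2) ((t - b / c) / 2)) := by
  have hc := hT.speed_pos
  have hb' : 0 ≤ b / c := by positivity
  have hbt' : b / c < t := (div_lt_iff₀' hc).2 hbt
  obtain ⟨X, hm, hlaw, hind, hX⟩ := hT.exists_waitingTimes
  have hmY : Measurable fun ω (i : Fin (n + 1)) => X i ω := measurable_pi_lambda _ fun i => hm i
  have hE := measurableSet_exceed n (directionSign r) t (b / c)
  have hrest : Measurable fun (x : ℕ → ℝ) (i : Fin (n + 1)) => x i := by fun_prop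
  have h := (hind.comp measurable_id hrest).measure_inter_preimage_eq_mul _ _
    (measurableSet_singleton (c * directionSign r)) hE
  rw [← waitingLaw_exceed hT.poisson.rate_pos r n hb' hbt', ← hT.prob_sign r, ← hlaw n,
    Measure.map_apply hmY hE]
  refine Eq.trans (measure_congr ?_) h
  filter_upwards [ae_telegraphMax (V := V) hX (hb'.trans hbt'.le)] with ω hω
  refine propext ?_
  change ((V ω = c * directionSign r ∧ N t.toNNReal ω = n) ∧ b < telegraphMax V N t ω) ↔
    (V ω = c * directionSign r ∧ Straddles n t (fun i => X i ω) ∧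
      b / c < peak n (directionSign r) t (fun i => X i ω))
  rw [and_assoc, ← hω.2.2 n]
  refine and_congr_right fun hV => and_congr_right fun hN => ?_
  -- Speed `c` at level `b` is speed `1` at level `b / c`.
  rw [hω.2.1, hV, hN, peak_const_mul hc.le, div_lt_iff₀' hc]

lemma prob_cond_ne_zero (hT : IsTelegraphData P c lam V N) {t : ℝ} (ht : 0 < t) (r : Bool)
    (n : ℕ) : P {ω | V ω = c * directionSign r ∧ N t.toNNReal ω = n} ≠ 0 := by
  have hl := hT.poisson.rate_pos
  rw [prob_cond hT ht.le]
  refine mul_ne_zero (by simp) (ENNReal.ofReal_pos.2 (by positivity)).ne'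

lemma aemeasurable_telegraphMax_cond (hT : IsTelegraphData P c lam V N) {t : ℝ} (ht : 0 ≤ t)
    (A : Set Ω) : AEMeasurable (telegraphMax V N t) (P[|A]) :=
  (aemeasurable_telegraphMax hT ht).mono_ac cond_absolutelyContinuous

lemma isProbabilityMeasure_condMaxLaw (hT : IsTelegraphData P c lam V N) {t : ℝ} (ht : 0 < t)
    (r : Bool) (n : ℕ) : IsProbabilityMeasure (condMaxLaw P V N t (c * directionSign r) n) := by
  have := cond_isProbabilityMeasure (prob_cond_ne_zero hT ht r n)
  exact Measure.isProbabilityMeasure_map (aemeasurable_telegraphMax_cond hT ht.le _)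

/-- The tail of the conditional law of the maximum. -/
lemma condMaxLaw_Ioi (hT : IsTelegraphData P c lam V N) {t b : ℝ} (hb : 0 ≤ b)
    (hbt : b < c * t) (r : Bool) (n : ℕ) :
    condMaxLaw P V N t (c * directionSign r) n (Ioi b) = ENNReal.ofReal
      (n.factorial / t ^ n * exceedVolume r n ((t + b / c) / 2) ((t - b / c) / 2)) := by
  have hc := hT.speed_pos
  have hl := hT.poisson.rate_pos
  have ht : 0 < t := pos_of_mul_pos_right (hb.trans_lt hbt) hc.le
  rw [condMaxLaw, Measure.map_apply_of_aemeasurable (aemeasurable_telegraphMax_cond hT ht.le _)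
    measurableSet_Ioi, cond_apply (measurableSet_cond hT t _ n), prob_cond hT ht.le,
    prob_exceed hT hb hbt, show (1 / 2 : ℝ≥0∞) = ENNReal.ofReal (1 / 2) by
      rw [ENNReal.ofReal_div_of_pos two_pos]; simp,
    ← ENNReal.ofReal_mul (by norm_num), ← ENNReal.ofReal_mul (by norm_num),
    ← ENNReal.ofReal_inv_of_pos (by positivity), ← ENNReal.ofReal_mul (by positivity)]
  congr 1
  field_simp

/-- The density of the conditional law of the maximum. -/
noncomputable def condMaxDensity (c t : ℝ) (r : Bool) (n : ℕ) (b : ℝ) : ℝ :=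
  n.factorial / t ^ n * (exceedDensity r n ((t + b / c) / 2) ((t - b / c) / 2) / c)

lemma isDensityOn_condMaxLaw (hT : IsTelegraphData P c lam V N) {t : ℝ} (ht : 0 < t)
    {r : Bool} {n : ℕ} (hn : r = true → n ≠ 0) :
    IsDensityOn (condMaxLaw P V N t (c * directionSign r) n) (Ioo 0 (c * t)) (condMaxDensity c t r n) := by
  have hc := hT.speed_pos
  have := isProbabilityMeasure_condMaxLaw hT ht r n
  have hlt : ∀ {b}, b < c * t → 0 ≤ (t - b / c) / 2 := fun {b} hb => by
    have : b / c < t := (div_lt_iff₀' hc).2 hb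
    linarith
  refine isDensityOn_of_tail (T := fun b =>
    n.factorial / t ^ n * exceedVolume r n ((t + b / c) / 2) ((t - b / c) / 2))
    (fun b h0 hb => condMaxLaw_Ioi hT h0 hb r n) (fun b h0 hb => ?_) (fun b => ?_) ?_
    (fun b hb => ?_)
  · exact mul_nonneg (by positivity) (exceedVolume_nonneg (by positivity) (hlt hb))
  · have h := ((hasDerivAt_exceedVolume_level hn t (b / c)).comp b
      ((hasDerivAt_id b).div_const c)).const_mul (n.factorial / t ^ n)
    exact h.congr_deriv (by unfold condMaxDensity; ring)
  · exact continuous_const.mul (((continuous_exceedDensity r n).comp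
      (f := fun b : ℝ => ((t + b / c) / 2, (t - b / c) / 2)) (by fun_prop)).div_const c)
  · have := hb.1
    exact mul_nonneg (by positivity)
      (div_nonneg (exceedDensity_nonneg (by positivity) (hlt hb.2)) hc.le)

/-- The atom at `0` of the conditional law of the maximum. -/
lemma condMaxLaw_zero (hT : IsTelegraphData P c lam V N) {t : ℝ} (ht : 0 < t) (k : ℕ) :
    condMaxLaw P V N t (c * directionSign false) (2 * k + 1) {0}
      = ENNReal.ofReal (((2 * k + 1).choose k : ℝ) / 2 ^ (2 * k + 1)) := by
  have hc := hT.speed_pos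
  have := isProbabilityMeasure_condMaxLaw hT ht false (2 * k + 1)
  set μ := condMaxLaw P V N t (c * directionSign false) (2 * k + 1) with hμ
  have hneg : μ (Iio 0) = 0 := by
    obtain ⟨X, -, -, -, hX⟩ := hT.exists_waitingTimes
    rw [hμ, condMaxLaw, Measure.map_apply_of_aemeasurable
      (aemeasurable_telegraphMax_cond hT ht.le _) measurableSet_Iio]
    refine cond_absolutelyContinuous ?_
    have h : ∀ᵐ ω ∂P, 0 ≤ telegraphMax V N t ω := by
      filter_upwards [ae_telegraphMax (V := V) hX ht.le] with ω hω
      rw [hω.2.1]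
      exact peak_nonneg _ _ _ _
    rw [ae_iff] at h
    simp only [not_le] at h
    exact h
  have hpos : μ (Ioi 0) = ENNReal.ofReal (1 - ((2 * k + 1).choose k : ℝ) / 2 ^ (2 * k + 1)) := by
    rw [hμ, condMaxLaw_Ioi hT le_rfl (by positivity)]
    congr 1
    -- The tail at `0` sums the binomials over `j < k + 1` and over `j < k`; compared with the full
    -- `2 ^ (2 * k + 1)` exactly the term `j = k` is missing.
    have hs := sum_choose_half_add (2 * k + 1)
    simp only [exceedVolume, Bool.false_eq_true, if_false, zero_div, add_zero, sub_zero]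
    rw [partialBinomial_self (by omega), partialBinomial_self (by omega), ← mul_add]
    rw [show (2 * k + 1) / 2 + 1 = k + 1 by omega, Finset.sum_range_succ _ k, ← add_assoc] at hs
    rw [show (2 * k + 1) / 2 = k by omega, eq_sub_of_add_eq hs]
    have : ((2 * k + 1).factorial : ℝ) ≠ 0 := by positivity
    rw [div_pow]
    field_simp
  have hle : ((2 * k + 1).choose k : ℝ) / 2 ^ (2 * k + 1) ≤ 1 := by
    rw [div_le_one (by positivity)]
    exact_mod_cast Nat.choose_le_two_pow _ _
  have h0 : ({0} : Set ℝ) =ᵐ[μ] Iic 0 := by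
    rw [← Iio_union_right]
    exact (union_ae_eq_right_of_ae_eq_empty (ae_eq_empty.2 hneg)).symm
  rw [measure_congr h0, ← compl_Ioi, prob_compl_eq_one_sub measurableSet_Ioi, hpos,
    ← ENNReal.ofReal_one, ← ENNReal.ofReal_sub _ (sub_nonneg.2 hle), sub_sub_cancel]

end

/-! ### Algebraic identities for the densities -/

/-- The summands do not match one by one: writing `t = p + q` over the common denominator, the first
one splits and its `p ^ k * q ^ k` part joins the second. -/
lemma leftOddDensity_eq {c t : ℝ} (hc : 0 < c) (ht : 0 < t) (k : ℕ) (b : ℝ) :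
    leftOddDensity c t k b = condMaxDensity c t false (2 * k + 1) b := by
  obtain ⟨p, hp⟩ : ∃ p, p = (t + b / c) / 2 := ⟨_, rfl⟩
  obtain ⟨q, hq⟩ : ∃ q, q = (t - b / c) / 2 := ⟨_, rfl⟩
  have hb : b = c * (p - q) := by rw [hp, hq]; field_simp; ring
  have ht' : t = p + q := by rw [hp, hq]; ring
  have h1 : c ^ 2 * t ^ 2 - b ^ 2 = (2 * c) ^ 2 * (p * q) := by rw [hb, ht']; ring
  have h2 : c * t - b = 2 * c * q := by rw [hb, ht']; ring
  have hpq : p + q ≠ 0 := ht' ▸ ht.ne'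
  rw [leftOddDensity, condMaxDensity, h1, h2, ← hp, ← hq, exceedDensity, if_neg (by simp),
    show (2 * k + 1 + 1) / 2 = k + 1 by omega, show (2 * k + 1) / 2 = k by omega]
  simp only [binomialTerm, Nat.succ_ne_zero, if_false, Nat.add_sub_cancel,
    show 2 * k + 1 - (k + 1) = k by omega, show 2 * k + 1 - k = k + 1 by omega]
  rw [ht']
  cases k with
  | zero => simp; field_simp; simp
  | succ k =>
    simp only [Nat.succ_ne_zero, if_false, Nat.add_sub_cancel, Nat.factorial_succ (k + 1),
      Nat.factorial_succ k, mul_pow, pow_succ, pow_mul]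
    have : (k.factorial : ℝ) ≠ 0 := by positivity
    push_cast
    field_simp
    ring

/-- Raising the even-order density to denominator `t ^ (2 * k + 1)` multiplies it by `p + q`; its
`q` part gives one monomial of the left side, and its `p` part joins the right-start density to give
the other. -/
lemma condMaxDensity_recursion {c t : ℝ} (hc : 0 < c) (ht : 0 < t) (k : ℕ) (b : ℝ) :
    condMaxDensity c t false (2 * k + 1) b
      = (2 * k + 1) / (2 * k + 2) * condMaxDensity c t false (2 * k) b
        + 1 / (2 * k + 2) * condMaxDensity c t true (2 * k + 1) b := by
  obtain ⟨p, hp⟩ : ∃ p, p = (t + b / c) / 2 := ⟨_, rfl⟩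
  obtain ⟨q, hq⟩ : ∃ q, q = (t - b / c) / 2 := ⟨_, rfl⟩
  have ht' : t = p + q := by rw [hp, hq]; ring
  have hpq : p + q ≠ 0 := ht' ▸ ht.ne'
  simp only [condMaxDensity, exceedDensity, Bool.false_eq_true, if_false, if_true, ← hp, ← hq,
    show (2 * k + 1 + 1) / 2 = k + 1 by omega, show (2 * k + 1) / 2 = k by omega,
    show 2 * k / 2 = k by omega, binomialTerm, Nat.succ_ne_zero, Nat.add_sub_cancel,
    show 2 * k + 1 - (k + 1) = k by omega, show 2 * k + 1 - k = k + 1 by omega,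
    show 2 * k - k = k by omega]
  rw [ht']
  cases k with
  | zero => simp; field_simp; norm_num
  | succ k =>
    simp only [Nat.succ_ne_zero, if_false, Nat.add_sub_cancel, Nat.factorial_succ (2 * (k + 1)),
      Nat.factorial_succ (k + 1), Nat.factorial_succ k, pow_succ, pow_mul]
    have : (k.factorial : ℝ) ≠ 0 := by positivity
    push_cast
    field_simp
    ring

theorem mainTheorem4 {Ω : Type*} [MeasurableSpace Ω] (P : Measure Ω) [IsProbabilityMeasure P]
    (c lam : ℝ) (V : Ω → ℝ) (N : ℝ≥0 → Ω → ℕ) (hT : IsTelegraphData P c lam V N)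
    (t : ℝ) (ht : 0 < t) (k : ℕ) :
    AEMeasurable (telegraphMax V N t) P ∧
    (∀ᵐ ω ∂P, IsGreatest ((fun s => telegraph V N s ω) '' Icc 0 t) (telegraphMax V N t ω)) ∧
    P {ω | V ω = -c ∧ N t.toNNReal ω = 2 * k + 1} ≠ 0 ∧
    IsDensityOn (condMaxLaw P V N t (-c) (2 * k + 1)) (Ioo 0 (c * t)) (leftOddDensity c t k) ∧
    (∃ g h : ℝ → ℝ,
      IsDensityOn (condMaxLaw P V N t (-c) (2 * k)) (Ioo 0 (c * t)) g ∧
      IsDensityOn (condMaxLaw P V N t c (2 * k + 1)) (Ioo 0 (c * t)) h ∧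
      ∀ β ∈ Ioo 0 (c * t), leftOddDensity c t k β =
        (2 * k + 1) / (2 * k + 2) * g β + 1 / (2 * k + 2) * h β) ∧
    condMaxLaw P V N t (-c) (2 * k + 1) {0} =
      ENNReal.ofReal (((2 * k + 1).choose k : ℝ) / 2 ^ (2 * k + 1)) := by
  have hc := hT.speed_pos
  have hl : c * directionSign false = -c := by simp [directionSign]
  have hr : c * directionSign true = c := by simp [directionSign]
  obtain ⟨X, -, -, -, hX⟩ := hT.exists_waitingTimes
  have hden : leftOddDensity c t k = condMaxDensity c t false (2 * k + 1) :=
    funext (leftOddDensity_eq hc ht k)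
  refine ⟨aemeasurable_telegraphMax hT ht.le, ?_, ?_, ?_, ?_, ?_⟩
  · filter_upwards [ae_telegraphMax (V := V) hX ht.le] with ω hω using hω.1
  · rw [← hl]; exact prob_cond_ne_zero hT ht false _
  · rw [← hl, hden]; exact isDensityOn_condMaxLaw hT ht (by simp)
  · refine ⟨condMaxDensity c t false (2 * k), condMaxDensity c t true (2 * k + 1), ?_, ?_,
      fun b _ => ?_⟩
    · rw [← hl]; exact isDensityOn_condMaxLaw hT ht (by simp)
    · have h := isDensityOn_condMaxLaw hT ht (r := true) (n := 2 * k + 1) (by simp)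
      rwa [hr] at h
    · rw [hden]; exact condMaxDensity_recursion hc ht k b
  · rw [← hl]; exact condMaxLaw_zero hT ht k
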